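/- Let $G=(V,E)$ be a finite simple chordal graph, i.e. $G$ has no induced cycle on four or more vertices. Let $\mathcal{K}(G)$ be the set of inclusion-wise maximal cliques of $G$, $\mathcal{T}(G)$ the set of triangles of $G$, and $\mathcal{I}(G)$ the set of induced paths of $G$ with at least one edge, where triangles, paths and cliques are regarded as vertex sets. Let $Q(G)\subseteq\mathbb{R}^{V}\times\mathbb{R}^{\mathcal{T}(G)}\times\mathbb{R}^{\mathcal{I}(G)}$ be the set of all $(x,t,p)$ satisfying $$\sum_{v\in K}x_v-\sum_{T\in\mathcal{T}(G):\,|T\cap K|=2}t_T-2\sum_{T\in\mathcal{T}(G):\,|T\cap K|=3}t_T-\sum_{P\in\mathcal{I}(G):\,|P\cap K|=2}p_P\le 1\qquad\text{for all }K\in\mathcal{K}(G),$$ $$\sum_{T\in\mathcal{T}(G):\,v\in T}t_T+\sum_{P\in\mathcal{I}(G):\,v\in P}p_P\le x_v\qquad\text{for all }v\in V,$$ $$t_T\ge 0\ \text{ for all }T\in\mathcal{T}(G),\qquad p_P\ge 0\ \text{ for all }P\in\mathcal{I}(G).$$ Then $Q(G)$ is an integer polytope, i.e. it is bounded and each of its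 non-empty faces contains a point with integer coordinates. Moreover, the co-3-plex polytope of $G$, i.e. the convex hull in $\mathbb{R}^V$ of the incidence vectors of the sets $S\subseteq V$ for which the induced subgraph $G[S]$ has maximum degree at most $2$, is equal to the orthogonal projection of $Q(G)$ onto the $x$-variables, i.e. $$\{x\in\mathbb{R}^V:\ (x,t,p)\in Q(G)\text{ for some }t\in\mathbb{R}^{\mathcal{T}(G)},\ p\in\mathbb{R}^{\mathcal{I}(G)}\}.$$ -/

import Mathlib

open scoped Finset

namespace SimpleGraph

variable {V : Type*}

/-- A graph is chordal if it has no hole (induced cycle) on four or more vertices. -/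
def IsChordal (G : SimpleGraph V) : Prop :=
  ∀ n : ℕ, 4 ≤ n → ¬ (cycleGraph n).IsIndContained G

/-- `S` is a co-`k`-plex: in the subgraph induced by `S`, every degree is at most `k - 1`. -/
def IsCoPlex (G : SimpleGraph V) (k : ℕ) (S : Finset V) : Prop :=
  ∀ v ∈ S, {w | w ∈ S ∧ G.Adj v w}.ncard < k

/-- The incidence vector of a vertex set. -/
noncomputable def incidenceVec (S : Finset V) : V → ℝ :=
  Set.indicator (S : Set V) 1

/-- The co-3-plex polytope: the convex hull of the incidence vectors of the co-3-plexes. -/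
def coThreePlexPolytope (G : SimpleGraph V) : Set (V → ℝ) :=
  convexHull ℝ {x | ∃ S : Finset V, G.IsCoPlex 3 S ∧ x = incidenceVec S}

/-- `P` induces a path with at least one edge: its elements can be ordered into a sequence
`f 0, …, f n` with `n ≥ 1`, the adjacent pairs being exactly the consecutive ones. -/
def IsInducedPathSet (G : SimpleGraph V) (P : Finset V) : Prop :=
  ∃ n : ℕ, 1 ≤ n ∧ ∃ f : pathGraph (n + 1) ↪g G, Set.range f = (P : Set V)

/-- The triangles of `G`, as vertex sets. -/
abbrev Triangle (G : SimpleGraph V) : Type _ := {T : Finset V // G.IsNClique 3 T}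

/-- The induced paths of `G` with at least one edge, as vertex sets. -/
abbrev InducedPath (G : SimpleGraph V) : Type _ := {P : Finset V // G.IsInducedPathSet P}

noncomputable instance instFintypeTriangle [Finite V] (G : SimpleGraph V) :
    Fintype G.Triangle := Fintype.ofFinite _

noncomputable instance instFintypeInducedPath [Finite V] (G : SimpleGraph V) :
    Fintype G.InducedPath := Fintype.ofFinite _

/-- The space of the variables `(x, t, p)`, indexed by the vertices, the triangles and the
induced paths of `G`. -/
abbrev ExtSpace (G : SimpleGraph V) : Type _ :=
  (V → ℝ) × (G.Triangle → ℝ) × (G.InducedPath → ℝ)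

/-- `t(𝒯_K^i)`: the sum of `t_T` over the triangles with exactly `i` vertices in `K`. -/
noncomputable def triangleSum [Fintype V] [DecidableEq V] (G : SimpleGraph V)
    (t : G.Triangle → ℝ) (K : Finset V) (i : ℕ) : ℝ :=
  ∑ T : G.Triangle with #(T.1 ∩ K) = i, t T

/-- `p(ℐ_K^i)`: the sum of `p_P` over the induced paths (with at least one edge) with exactly
`i` vertices in `K`. An induced path has at most two vertices in a clique, so for a clique `K`
and `i = 2`, and for a singleton `K` and `i = 1`, "exactly" and "at least" agree. -/
noncomputable def pathSum [Fintype V] [DecidableEq V] (G : SimpleGraph V)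
    (p : G.InducedPath → ℝ) (K : Finset V) (i : ℕ) : ℝ :=
  ∑ P : G.InducedPath with #(P.1 ∩ K) = i, p P

/-- The extended formulation: the solution set of the linear system in `(x, t, p)`. -/
def extendedPolytope [Fintype V] [DecidableEq V] (G : SimpleGraph V) : Set G.ExtSpace :=
  {y | (∀ K : Finset V, Maximal G.IsClique (K : Set V) →
          ∑ v ∈ K, y.1 v - G.triangleSum y.2.1 K 2 - 2 * G.triangleSum y.2.1 K 3
            - G.pathSum y.2.2 K 2 ≤ 1) ∧
       (∀ v : V, G.triangleSum y.2.1 {v} 1 + G.pathSum y.2.2 {v} 1 ≤ y.1 v) ∧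
       (∀ P, 0 ≤ y.2.2 P) ∧ (∀ T, 0 ≤ y.2.1 T)}

/-- All coordinates of the point are integers. -/
def IsIntegerPoint (G : SimpleGraph V) (y : G.ExtSpace) : Prop :=
  (∀ v, ∃ m : ℤ, y.1 v = m) ∧ (∀ T, ∃ m : ℤ, y.2.1 T = m) ∧ (∀ P, ∃ m : ℤ, y.2.2 P = m)

/-- A set of points `(x, t, p)` (in the application, a polyhedron) is integer if each of its
non-empty faces (the sets of maximisers of linear functionals, including the whole set)
contains an integer point. -/
def IsIntegerPolyhedron (G : SimpleGraph V) (Q : Set G.ExtSpace) : Prop :=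
  ∀ F : Set G.ExtSpace, IsExposed ℝ Q F → F.Nonempty → ∃ y ∈ F, G.IsIntegerPoint y

/-- The orthogonal projection of a set of points `(x, t, p)` onto the space of `x`. -/
def projX (G : SimpleGraph V) (Q : Set G.ExtSpace) : Set (V → ℝ) :=
  {x | ∃ (t : G.Triangle → ℝ) (p : G.InducedPath → ℝ), (x, t, p) ∈ Q}

end SimpleGraph

/-! Say that two vertex sets touch if they meet or are joined by an edge. In a chordal graph a
nonempty connected co-3-plex is a vertex, a triangle or an induced path
(`IsChordal.triangle_or_path`), so the co-3-plexes are exactly the unions of pairwise non-touching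
blocks of these three kinds, that is, of stable sets of the touching graph on the blocks.

Taking the slack of the vertex inequality at `v` as the weight of the block `{v}` turns the system
into: nonnegative block weights, with total at most one on the blocks meeting any given maximal
clique `K` (`extendedPolytope_eq_image`). Indeed a block with `m ≥ 1` vertices in `K` is counted `m`
times in the sum of `x` over `K`, and the `t` and `p` terms remove `m - 1` of these.

These weights form the stable set polytope of the touching graph (`IsChordal.feasibleWeights_eq`).
Fix a perfect elimination ordering of `G` and take the block whose last vertex `a` is earliest.
Every block touching it contains `a` or a later neighbour of `a`
(`IsPerfectElimination.exists_mem_of_touch`). These vertices form a clique, so the block and those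
touching it all meet one maximal clique: they touch pairwise and weigh at most one together.
Eliminating blocks in this order writes the weights as a convex combination of stable sets
(`mem_convexHull_of_elimination`). The extended polytope is therefore the hull of finitely many
integer points, whose `x`-parts are the incidence vectors of the co-3-plexes. -/

namespace SimpleGraph

variable {V : Type*}

/-! ### Connected vertex sets -/

/-- `C` cannot be split into two nonempty parts with no edge of `G` between them. -/
def IsCutConnected (G : SimpleGraph V) (C : Finset V) : Prop :=
  ∀ X ⊆ C, X.Nonempty → X ≠ C → ∃ x ∈ X, ∃ y ∈ C, y ∉ X ∧ G.Adj x y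

/-- Two vertex sets touch if they intersect or are joined by an edge. -/
def Touch (G : SimpleGraph V) (A B : Finset V) : Prop :=
  ∃ a ∈ A, ∃ b ∈ B, a = b ∨ G.Adj a b

theorem Touch.symm {G : SimpleGraph V} {A B : Finset V} (h : G.Touch A B) : G.Touch B A := by
  obtain ⟨a, ha, b, hb, h⟩ := h
  exact ⟨b, hb, a, ha, h.imp Eq.symm Adj.symm⟩

theorem isCutConnected_singleton (G : SimpleGraph V) (v : V) : G.IsCutConnected {v} := by
  intro X hX hne hne'
  exact absurd ((Finset.subset_singleton_iff.1 hX).resolve_left hne.ne_empty) hne'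

theorem IsClique.isCutConnected {G : SimpleGraph V} {C : Finset V}
    (h : G.IsClique (C : Set V)) : G.IsCutConnected C := by
  intro X hX hne hne'
  obtain ⟨x, hx⟩ := hne
  obtain ⟨y, hy, hyX⟩ := Finset.exists_of_ssubset (hX.ssubset_of_ne hne')
  exact ⟨x, hx, y, hy, hyX, h (hX hx) hy (fun e => hyX (e ▸ hx))⟩

theorem IsCutConnected.union [DecidableEq V] {G : SimpleGraph V} {A B : Finset V}
    (hA : G.IsCutConnected A) (hB : G.IsCutConnected B) (h : G.Touch A B) :
    G.IsCutConnected (A ∪ B) := by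
  intro X hX hne hne'
  by_contra! hcon
  -- No edge leaves `X`, so a connected subset that meets `X` lies inside it.
  have key : ∀ C, G.IsCutConnected C → C ⊆ A ∪ B → (∃ x ∈ X, x ∈ C) → C ⊆ X := by
    intro C hC hCAB hx
    by_contra hCX
    obtain ⟨x, hx, hxC⟩ := hx
    obtain ⟨a, ha, b, hb, hbX, hab⟩ := hC (X ∩ C) Finset.inter_subset_right
      ⟨x, Finset.mem_inter.2 ⟨hx, hxC⟩⟩ (fun e => hCX (Finset.inter_eq_right.1 e))
    exact hcon a (Finset.mem_inter.1 ha).1 b (hCAB hb)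
      (fun h => hbX (Finset.mem_inter.2 ⟨h, hb⟩)) hab
  have kA := key A hA Finset.subset_union_left
  have kB := key B hB Finset.subset_union_right
  obtain ⟨a, ha, b, hb, hab⟩ := h
  have iff : a ∈ X ↔ b ∈ X := by
    rcases hab with rfl | hab
    · rfl
    · constructor
      · intro h; by_contra h'; exact hcon a h b (by simp [hb]) h' hab
      · intro h; by_contra h'; exact hcon b h a (by simp [ha]) h' hab.symm
  have hAX : A ⊆ X ∧ B ⊆ X := by
    obtain ⟨x, hx⟩ := hne
    rcases Finset.mem_union.1 (hX hx) with h | h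
    · have := kA ⟨x, hx, h⟩
      exact ⟨this, kB ⟨b, iff.1 (this ha), hb⟩⟩
    · have := kB ⟨x, hx, h⟩
      exact ⟨kA ⟨a, iff.2 (this hb), ha⟩, this⟩
  exact hne' (hX.antisymm (Finset.union_subset hAX.1 hAX.2))

/-- Deleting a simplicial vertex preserves connectedness. -/
theorem IsCutConnected.erase [DecidableEq V] {G : SimpleGraph V} {C : Finset V} {v : V}
    (hC : G.IsCutConnected C)
    (hv : ∀ a ∈ C, ∀ b ∈ C, G.Adj v a → G.Adj v b → a ≠ b → G.Adj a b) :
    G.IsCutConnected (C.erase v) := by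
  by_cases hvC : v ∈ C
  swap
  · rwa [Finset.erase_eq_of_notMem hvC]
  intro X hX hne hne'
  have hXC : X ⊆ C := hX.trans (Finset.erase_subset _ _)
  have hvX : v ∉ X := fun h => Finset.notMem_erase v C (hX h)
  by_cases hx : ∃ x ∈ X, G.Adj v x
  · obtain ⟨x, hx, hvx⟩ := hx
    -- Add `v` to `X` and take an edge leaving the larger set; if it starts at `v`, simpliciality
    -- lets `x` replace `v`.
    obtain ⟨a, ha, b, hb, hbX, hab⟩ := hC (insert v X) (Finset.insert_subset hvC hXC)
      (Finset.insert_nonempty _ _) (fun e => hne' (by rw [← e, Finset.erase_insert hvX]))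
    rw [Finset.mem_insert, not_or] at hbX
    have hb' : b ∈ C.erase v := Finset.mem_erase.2 ⟨hbX.1, hb⟩
    rcases Finset.mem_insert.1 ha with rfl | ha
    · exact ⟨x, hx, b, hb', hbX.2, hv x (hXC hx) b hb hvx hab (fun e => hbX.2 (e ▸ hx))⟩
    · exact ⟨a, ha, b, hb', hbX.2, hab⟩
  · push Not at hx
    obtain ⟨a, ha, b, hb, hbX, hab⟩ := hC X hXC hne (fun e => hvX (e ▸ hvC))
    refine ⟨a, ha, b, Finset.mem_erase.2 ⟨?_, hb⟩, hbX, hab⟩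
    rintro rfl
    exact hx a ha hab.symm

/-- Every nonempty finite vertex set contains a connected part with no edge to its complement. -/
theorem exists_component [DecidableEq V] (G : SimpleGraph V) {U : Finset V} (hU : U.Nonempty) :
    ∃ C ⊆ U, C.Nonempty ∧ G.IsCutConnected C ∧ ∀ c ∈ C, ∀ u ∈ U, G.Adj c u → u ∈ C := by
  obtain ⟨C, hCU, hC⟩ := exists_minimal_le_of_wellFoundedLT
    (fun C : Finset V => C ⊆ U ∧ C.Nonempty ∧ ∀ c ∈ C, ∀ u ∈ U, G.Adj c u → u ∈ C) U
    ⟨subset_rfl, hU, fun _ _ u hu _ => hu⟩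
  refine ⟨C, hCU, hC.prop.2.1, fun X hX hne hne' => ?_, hC.prop.2.2⟩
  by_contra! hcon
  refine hne' (hX.antisymm (hC.le_of_le ⟨hX.trans hCU, hne, fun c hc u hu hcu => ?_⟩ hX))
  by_contra hu'
  exact hcon c hc u (hC.prop.2.2 c (hX hc) u hu hcu) hu' hcu

/-! ### Shortest walks and simplicial vertices -/

/-- The spanning subgraph of `G` keeping only the edges inside `D`. -/
def edgesOn (G : SimpleGraph V) (D : Finset V) : SimpleGraph V where
  Adj a b := a ∈ D ∧ b ∈ D ∧ G.Adj a b
  symm := ⟨fun _ _ h => ⟨h.2.1, h.1, h.2.2.symm⟩⟩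
  loopless := ⟨fun _ h => h.2.2.ne rfl⟩

theorem IsCutConnected.reachable {G : SimpleGraph V} {D : Finset V}
    (hD : G.IsCutConnected D) {x y : V} (hx : x ∈ D) (hy : y ∈ D) :
    (G.edgesOn D).Reachable x y := by
  classical
  by_contra hcon
  obtain ⟨a, ha, b, hb, hbX, hab⟩ := hD {z ∈ D | (G.edgesOn D).Reachable x z}
    (Finset.filter_subset _ _) ⟨x, by simp [hx]⟩ (fun e => by
      rw [← e] at hy; exact hcon (Finset.mem_filter.1 hy).2)
  rw [Finset.mem_filter] at ha
  have : (G.edgesOn D).Adj a b := ⟨ha.1, hb, hab⟩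
  exact hbX (Finset.mem_filter.2 ⟨hb, ha.2.trans this.reachable⟩)

/-- The vertices of a shortest walk induce a path. -/
theorem exists_induced_sequence {G : SimpleGraph V} {D : Finset V}
    (hD : G.IsCutConnected D) {x y : V} (hx : x ∈ D) (hy : y ∈ D) :
    ∃ (n : ℕ) (f : ℕ → V), f 0 = x ∧ f n = y ∧ (∀ i ≤ n, f i ∈ D) ∧
      ∀ i j, i < j → j ≤ n → f i ≠ f j ∧ (G.Adj (f i) (f j) ↔ j = i + 1) := by
  obtain ⟨p, hp⟩ := (hD.reachable hx hy).exists_walk_length_eq_dist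
  have hreach : ∀ i, (G.edgesOn D).Reachable x (p.getVert i) := fun i => ⟨p.take i⟩
  -- The `i`-th vertex of a shortest walk is at distance exactly `i` from its start, which rules out
  -- repetitions and chords.
  have hdist : ∀ i ≤ p.length, (G.edgesOn D).dist x (p.getVert i) = i := by
    intro i hi
    have h1 := dist_le (p.take i)
    have h2 := dist_le (p.drop i)
    have h3 := (hreach i).dist_triangle_left y
    simp only [Walk.take_length, Walk.drop_length] at h1 h2
    omega
  have hmem : ∀ i ≤ p.length, p.getVert i ∈ D := by
    intro i hi
    cases i with
    | zero => simpa using hx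
    | succ i => exact (p.adj_getVert_succ (i := i) (by omega)).2.1
  refine ⟨p.length, p.getVert, by simp, by simp, hmem, fun i j hij hj => ⟨fun e => ?_, ?_, ?_⟩⟩
  · have h1 := hdist i (by omega)
    have h2 := hdist j hj
    rw [e] at h1
    omega
  · intro hadj
    have hadj' : (G.edgesOn D).Adj (p.getVert i) (p.getVert j) :=
      ⟨hmem i (by omega), hmem j hj, hadj⟩
    have h1 := (hreach i).dist_triangle_left (p.getVert j)
    rw [dist_eq_one_iff_adj.2 hadj', hdist i (by omega), hdist j hj] at h1
    omega
  · rintro rfl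
    exact (p.adj_getVert_succ (by omega)).2.2

/-- In a chordal graph, two neighbours of `v` that are joined by a connected set avoiding the
closed neighbourhood of `v` are adjacent. -/
theorem IsChordal.adj_of_common_component [DecidableEq V] {G : SimpleGraph V} (hG : G.IsChordal)
    {C : Finset V} (hC : G.IsCutConnected C) {v x y : V} (hvC : v ∉ C)
    (hv : ∀ c ∈ C, ¬ G.Adj v c) (hvx : G.Adj v x) (hvy : G.Adj v y) (hxy : x ≠ y)
    (hx : ∃ c ∈ C, G.Adj c x) (hy : ∃ c ∈ C, G.Adj c y) : G.Adj x y := by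
  by_contra hnadj
  obtain ⟨c, hc, hcx⟩ := hx
  obtain ⟨d, hd, hdy⟩ := hy
  have hD : G.IsCutConnected ((C ∪ {x}) ∪ {y}) :=
    (hC.union (isCutConnected_singleton G x) ⟨c, hc, x, by simp, Or.inr hcx⟩).union
      (isCutConnected_singleton G y) ⟨d, by simp [hd], y, by simp, Or.inr hdy⟩
  obtain ⟨n, f, h0, hn, hmem, hf⟩ := exists_induced_sequence hD (x := x) (y := y)
    (by simp) (by simp)
  have hn2 : 2 ≤ n := by
    by_contra hlt
    have : n = 0 ∨ n = 1 := by omega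
    rcases this with rfl | rfl
    · exact hxy (h0.symm.trans hn)
    · exact hnadj (h0 ▸ hn ▸ (hf 0 1 (by omega) le_rfl).2.2 rfl)
  have hfv : ∀ i ≤ n, f i ≠ v ∧ (G.Adj (f i) v ↔ i = 0 ∨ i = n) := by
    intro i hi
    rcases Nat.eq_zero_or_pos i with rfl | hpos
    · rw [h0]; exact ⟨hvx.ne', by simp [hvx.symm]⟩
    rcases eq_or_lt_of_le hi with rfl | hlt
    · rw [hn]; exact ⟨hvy.ne', by simp [hvy.symm]⟩
    have hiC : f i ∈ C := by
      have h1 := hmem i hi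
      simp only [Finset.mem_union, Finset.mem_singleton] at h1
      rcases h1 with (h1 | h1) | h1
      · exact h1
      · exact absurd (h0.trans h1.symm) (hf 0 i hpos hi).1
      · exact absurd (h1.trans hn.symm) (hf i n hlt le_rfl).1
    exact ⟨fun e => hvC (e ▸ hiC), fun h => absurd h.symm (hv _ hiC), fun h => by omega⟩
  -- The induced path from `x` to `y`, closed up by `v` at index `n + 1`, is an induced cycle; since
  -- `n ≥ 2` it has at least four vertices.
  let g : Fin (n + 2) → V := fun i => if i.1 ≤ n then f i.1 else v
  have hg : ∀ i j : Fin (n + 2), i < j →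
      g i ≠ g j ∧ (G.Adj (g i) (g j) ↔ (cycleGraph (n + 2)).Adj i j) := by
    intro i j hij
    have hij' : i.1 < j.1 := hij
    have hi : i.1 ≤ n := by omega
    have hcyc : (cycleGraph (n + 2)).Adj i j ↔ j.1 = i.1 + 1 ∨ (i.1 = 0 ∧ j.1 = n + 1) := by
      rw [cycleGraph_adj']
      have h1 : (j - i).1 = j.1 - i.1 := Fin.sub_val_of_le hij.le
      have h2 : (i - j).1 = n + 2 - (j.1 - i.1) := by
        rw [Fin.coe_sub_iff_lt.2 hij]; omega
      rw [h1, h2]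
      omega
    rw [hcyc]
    by_cases hj : j.1 ≤ n
    · simp only [g, hi, hj, if_true]
      refine ⟨(hf i.1 j.1 hij' hj).1, ?_⟩
      rw [(hf i.1 j.1 hij' hj).2]
      omega
    · simp only [g, hi, hj, if_true, if_false]
      refine ⟨(hfv i.1 hi).1, ?_⟩
      rw [(hfv i.1 hi).2]
      omega
  refine hG (n + 2) (by omega) ⟨⟨⟨g, fun i j hij => ?_⟩, fun {i j} => ?_⟩⟩
  · rcases lt_trichotomy i j with h | h | h
    · exact absurd hij (hg i j h).1
    · exact h
    · exact absurd hij.symm (hg j i h).1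
  · rcases lt_trichotomy i j with h | h | h
    · exact (hg i j h).2
    · subst h; simp
    · exact (G.adj_comm _ _).trans ((hg j i h).2.trans ((cycleGraph _).adj_comm _ _))

/-- Dirac: in a vertex set of a chordal graph, a vertex that does not dominate the set has a
non-neighbour that is simplicial in the set. -/
theorem IsChordal.exists_simplicial_not_adj [DecidableEq V] {G : SimpleGraph V}
    (hG : G.IsChordal) (W : Finset V) : ∀ v ∈ W, (∃ u ∈ W, u ≠ v ∧ ¬ G.Adj v u) →
      ∃ w ∈ W, w ≠ v ∧ ¬ G.Adj v w ∧
        ∀ a ∈ W, ∀ b ∈ W, G.Adj w a → G.Adj w b → a ≠ b → G.Adj a b := by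
  classical
  induction W using Finset.strongInduction with
  | H W ih =>
  intro v hvW hu
  obtain ⟨C, hCU, ⟨c₀, hc₀⟩, hC, hclosed⟩ :=
    G.exists_component (U := {u ∈ W | u ≠ v ∧ ¬ G.Adj v u}) (by
      obtain ⟨u, hu, h⟩ := hu
      exact ⟨u, Finset.mem_filter.2 ⟨hu, h⟩⟩)
  have hCW : ∀ c ∈ C, c ∈ W ∧ c ≠ v ∧ ¬ G.Adj v c := fun c hc => Finset.mem_filter.1 (hCU hc)
  -- `S` is the boundary in `W` of a component `C` of the non-neighbours of `v`. It lies in the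
  -- neighbourhood of `v`, and chordality makes it a clique.
  set S : Finset V := {s ∈ W | s ∉ C ∧ ∃ c ∈ C, G.Adj c s} with hS
  have hSv : ∀ s ∈ S, G.Adj v s := by
    intro s hs
    obtain ⟨hsW, hsC, c, hc, hcs⟩ := Finset.mem_filter.1 hs
    by_contra hvs
    refine hsC (hclosed c hc s (Finset.mem_filter.2 ⟨hsW, ?_, hvs⟩) hcs)
    rintro rfl
    exact (hCW c hc).2.2 hcs.symm
  have hSclique : ∀ a ∈ S, ∀ b ∈ S, a ≠ b → G.Adj a b := by
    intro a ha b hb hab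
    exact hG.adj_of_common_component hC (fun h => (hCW v h).2.1 rfl)
      (fun c hc => (hCW c hc).2.2) (hSv a ha) (hSv b hb) hab
      (Finset.mem_filter.1 ha).2.2 (Finset.mem_filter.1 hb).2.2
  have hsub : C ∪ S ⊂ W := by
    refine (Finset.ssubset_iff_of_subset ?_).2 ⟨v, hvW, ?_⟩
    · exact Finset.union_subset (fun c hc => (hCW c hc).1) (Finset.filter_subset _ _)
    · rw [Finset.mem_union, not_or]
      exact ⟨fun h => (hCW v h).2.1 rfl, fun h => (hSv v h).ne rfl⟩
  suffices h : ∃ w ∈ C, ∀ a ∈ C ∪ S, ∀ b ∈ C ∪ S, G.Adj w a → G.Adj w b → a ≠ b → G.Adj a b by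
    obtain ⟨w, hw, h⟩ := h
    refine ⟨w, (hCW w hw).1, (hCW w hw).2.1, (hCW w hw).2.2, ?_⟩
    have hN : ∀ a ∈ W, G.Adj w a → a ∈ C ∪ S := by
      intro a ha hwa
      by_cases haC : a ∈ C
      · simp [haC]
      · exact Finset.mem_union_right _ (Finset.mem_filter.2 ⟨ha, haC, w, hw, hwa⟩)
    exact fun a ha b hb hwa hwb => h a (hN a ha hwa) b (hN b hb hwb) hwa hwb
  -- Induction in `C ∪ S` must return a vertex of `C`. Started at `s ∈ S`, it gives a non-neighbour
  -- of `s`, which is outside the clique `S`. If every vertex of `S` dominates `C ∪ S`, a start in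
  -- `C` works for the same reason. If all vertices dominate, `C ∪ S` is a clique.
  by_cases h1 : ∃ s ∈ S, ∃ u ∈ C ∪ S, u ≠ s ∧ ¬ G.Adj s u
  · obtain ⟨s, hs, hu⟩ := h1
    obtain ⟨w, hw, hws, hsw, h⟩ := ih _ hsub s (Finset.mem_union_right _ hs) hu
    refine ⟨w, (Finset.mem_union.1 hw).resolve_right fun hwS => ?_, h⟩
    exact hsw (hSclique s hs w hwS hws.symm)
  push Not at h1
  by_cases h2 : ∃ c ∈ C, ∃ u ∈ C ∪ S, u ≠ c ∧ ¬ G.Adj c u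
  · obtain ⟨c, hc, hu⟩ := h2
    obtain ⟨w, hw, hwc, hcw, h⟩ := ih _ hsub c (Finset.mem_union_left _ hc) hu
    refine ⟨w, (Finset.mem_union.1 hw).resolve_right fun hwS => ?_, h⟩
    exact hcw (h1 w hwS c (Finset.mem_union_left _ hc) hwc.symm).symm
  push Not at h2
  refine ⟨c₀, hc₀, fun a ha b hb _ _ hab => ?_⟩
  rcases Finset.mem_union.1 ha with haC | haS
  · exact h2 a haC b hb hab.symm
  · exact h1 a haS b hb hab.symm

theorem IsChordal.exists_simplicial [DecidableEq V] {G : SimpleGraph V} (hG : G.IsChordal)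
    {W : Finset V} (hW : W.Nonempty) :
    ∃ w ∈ W, ∀ a ∈ W, ∀ b ∈ W, G.Adj w a → G.Adj w b → a ≠ b → G.Adj a b := by
  by_cases h : ∃ v ∈ W, ∃ u ∈ W, u ≠ v ∧ ¬ G.Adj v u
  · obtain ⟨v, hv, hu⟩ := h
    obtain ⟨w, hw, -, -, h⟩ := hG.exists_simplicial_not_adj W v hv hu
    exact ⟨w, hw, h⟩
  · push Not at h
    obtain ⟨w, hw⟩ := hW
    exact ⟨w, hw, fun a ha b hb _ _ hab => h a ha b hb hab.symm⟩

/-! ### Perfect elimination orderings -/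

/-- A perfect elimination ordering, given by a rank function. -/
def IsPerfectElimination (G : SimpleGraph V) (r : V → ℕ) : Prop :=
  ∀ v a b, r v < r a → r v < r b → G.Adj v a → G.Adj v b → a ≠ b → G.Adj a b

theorem IsChordal.exists_perfectElimination [Fintype V] [DecidableEq V] {G : SimpleGraph V}
    (hG : G.IsChordal) : ∃ r : V → ℕ, r.Injective ∧ G.IsPerfectElimination r := by
  suffices h : ∀ W : Finset V, ∃ r : V → ℕ, Set.InjOn r W ∧ ∀ v ∈ W, ∀ a ∈ W, ∀ b ∈ W,
      r v < r a → r v < r b → G.Adj v a → G.Adj v b → a ≠ b → G.Adj a b by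
    obtain ⟨r, h1, h2⟩ := h Finset.univ
    exact ⟨r, fun a b => h1 (by simp) (by simp), fun v a b => h2 v (by simp) a (by simp) b (by simp)⟩
  intro W
  induction W using Finset.strongInduction with
  | H W ih =>
  rcases W.eq_empty_or_nonempty with rfl | hW
  · exact ⟨fun _ => 0, by simp, by simp⟩
  obtain ⟨w, hw, hsimp⟩ := hG.exists_simplicial hW
  obtain ⟨r, h1, h2⟩ := ih _ (Finset.erase_ssubset hw)
  refine ⟨fun u => if u = w then 0 else r u + 1, ?_, ?_⟩
  · intro a ha b hb hab
    dsimp only at hab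
    split_ifs at hab with h h' h'
    · rw [h, h']
    · exact h1 (by simpa [h] using ha) (by simpa [h'] using hb) (Nat.succ_injective hab)
  · intro v hv a ha b hb hva hvb
    have haw : a ≠ w := by rintro rfl; simp at hva
    have hbw : b ≠ w := by rintro rfl; simp at hvb
    by_cases hvw : v = w
    · subst hvw; exact hsimp a ha b hb
    · simp only [hvw, haw, hbw, if_false, Nat.add_lt_add_iff_right] at hva hvb
      exact h2 v (by simp [hvw, hv]) a (by simp [haw, ha]) b (by simp [hbw, hb]) hva hvb

/-- The vertices of a connected set above a given rank form a connected set. -/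
theorem IsPerfectElimination.isCutConnected_filter [DecidableEq V] {G : SimpleGraph V} {r : V → ℕ}
    (hr : r.Injective) (hG : G.IsPerfectElimination r) {C : Finset V}
    (hC : G.IsCutConnected C) (k : ℕ) : G.IsCutConnected {v ∈ C | k ≤ r v} := by
  -- Raising the threshold by one removes at most one vertex, which is simplicial among those
  -- remaining.
  induction k with
  | zero => simpa using hC
  | succ k ih =>
    by_cases h : ∃ v, r v = k
    · obtain ⟨v, rfl⟩ := h
      have := ih.erase (v := v) (fun a ha b hb hva hvb hab => by
        rw [Finset.mem_filter] at ha hb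
        exact hG v a b (lt_of_le_of_ne ha.2 (fun e => hva.ne (hr e)))
          (lt_of_le_of_ne hb.2 (fun e => hvb.ne (hr e))) hva hvb hab)
      convert this using 1
      ext u
      simp only [Finset.mem_filter, Finset.mem_erase, Nat.succ_le_iff, lt_iff_le_and_ne]
      have : r v ≠ r u ↔ u ≠ v := by rw [hr.ne_iff, ne_comm]
      tauto
    · push Not at h
      rwa [Finset.filter_congr fun v _ => (Nat.succ_le_iff.trans
        ((le_iff_lt_or_eq.trans (or_iff_left (h v).symm)).symm) : k + 1 ≤ r v ↔ k ≤ r v)]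

/-- If `A` touches `B` and the last vertex `a` of `A` does not come after the last vertex of `B`,
then `B` meets the set formed by `a` and its later neighbours. -/
theorem IsPerfectElimination.exists_mem_of_touch [DecidableEq V] {G : SimpleGraph V} {r : V → ℕ}
    (hr : r.Injective) (hG : G.IsPerfectElimination r) {A B : Finset V}
    (hA : G.IsCutConnected A) (hB : G.IsCutConnected B) (h : G.Touch A B) {a b : V}
    (ha : a ∈ A) (hmax : ∀ u ∈ A, r u ≤ r a) (hb : b ∈ B) (hab : r a ≤ r b) :
    ∃ u ∈ B, u = a ∨ (r a < r u ∧ G.Adj a u) := by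
  by_cases he : a ∈ B
  · exact ⟨a, he, Or.inl rfl⟩
  have hC := hG.isCutConnected_filter hr (hA.union hB h) (r a)
  have hne : ({a} : Finset V) ≠ {v ∈ A ∪ B | r a ≤ r v} := by
    intro e
    have : b ∈ ({a} : Finset V) := e ▸ Finset.mem_filter.2 ⟨by simp [hb], hab⟩
    exact he (Finset.mem_singleton.1 this ▸ hb)
  -- An edge leaving `{a}` inside the connected upper part of `A ∪ B` ends at a later neighbour of
  -- `a`; this lies in `B` because `a` is last in `A`.
  obtain ⟨x, hx, y, hy, -, hxy⟩ := hC {a} (by simp [ha]) (by simp) hne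
  rw [Finset.mem_singleton] at hx
  subst hx
  rw [Finset.mem_filter, Finset.mem_union] at hy
  have hlt : r x < r y := lt_of_le_of_ne hy.2 (fun e => hxy.ne (hr e))
  exact ⟨y, hy.1.resolve_left (fun h => (hmax y h).not_gt hlt), Or.inr ⟨hlt, hxy⟩⟩

/-! ### Convex combinations of stable sets -/

theorem incidenceVec_apply {ι : Type*} [DecidableEq ι] (S : Finset ι) (i : ι) :
    incidenceVec S i = if i ∈ S then 1 else 0 := by
  simp [incidenceVec, Set.indicator_apply]

/-- A weight vector satisfying the neighbourhood inequalities along a perfect elimination scheme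
of `rel` is a convex combination of incidence vectors of stable sets. -/
theorem mem_convexHull_of_elimination {ι : Type*} [DecidableEq ι] (rel : ι → ι → Prop)
    (hsymm : ∀ i j, rel i j → rel j i) (z : ι → ℝ) (hz : ∀ i, 0 ≤ z i) (J : Finset ι)
    (h : ∀ I ⊆ J, I.Nonempty → ∃ a ∈ I, ∃ N ⊆ I.erase a, (∀ b ∈ I, b ≠ a → rel a b → b ∈ N) ∧
      (∀ b ∈ N, ∀ c ∈ N, b ≠ c → rel b c) ∧ z a + ∑ b ∈ N, z b ≤ 1) :
    (fun i => if i ∈ J then z i else 0) ∈ convexHull ℝ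
      {y : ι → ℝ | ∃ S ⊆ J, (∀ b ∈ S, ∀ c ∈ S, b ≠ c → ¬ rel b c) ∧ y = incidenceVec S} := by
  induction J using Finset.strongInduction with
  | H J ih =>
  rcases J.eq_empty_or_nonempty with rfl | hJ
  · refine subset_convexHull ℝ _ ⟨∅, subset_rfl, by simp, ?_⟩
    ext i
    simp [incidenceVec_apply]
  obtain ⟨a, haJ, N, hNJ, hN, hNN, hsum⟩ := h J subset_rfl hJ
  have hz' := ih _ (Finset.erase_ssubset haJ) (fun I hI => h I (hI.trans (Finset.erase_subset _ _)))
  set H := convexHull ℝ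
    {y : ι → ℝ | ∃ S ⊆ J, (∀ b ∈ S, ∀ c ∈ S, b ≠ c → ¬ rel b c) ∧ y = incidenceVec S} with hH
  set σ := ∑ b ∈ N, z b with hσ
  -- `α` is the share of the mass `1 - σ` avoiding `N` to which `a` is to be added. If `σ = 1`, then
  -- `z a = 0` and any share would do.
  obtain ⟨α, hα0, hα1, hα⟩ : ∃ α : ℝ, 0 ≤ α ∧ α ≤ 1 ∧ α * (1 - σ) = z a := by
    have := hz a
    rcases (show σ ≤ 1 by linarith).eq_or_lt with h1 | h1
    · exact ⟨0, le_rfl, zero_le_one, by linarith⟩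
    · refine ⟨z a / (1 - σ), div_nonneg this (by linarith), ?_, div_mul_cancel₀ _ (by linarith)⟩
      rw [div_le_one (by linarith)]
      linarith
  -- This affine map restores coordinate `a`. A stable set disjoint from `N` goes to the mixture of
  -- itself and its extension by `a`. One meeting `N` does so exactly once, as `N` is pairwise
  -- related, and is fixed.
  let ψ : (ι → ℝ) → ι → ℝ := fun y i => y i + if i = a then α * (1 - ∑ b ∈ N, y b) else 0
  have hconv : Convex ℝ (ψ ⁻¹' H) := by
    intro x hx y hy s t hs ht hst
    have : ψ (s • x + t • y) = s • ψ x + t • ψ y := by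
      ext i
      simp only [ψ, Pi.add_apply, Pi.smul_apply, smul_eq_mul, Finset.sum_add_distrib,
        ← Finset.mul_sum]
      split_ifs
      · linear_combination (-α) * hst
      · ring
    rw [Set.mem_preimage, this]
    exact convex_convexHull ℝ _ hx hy hs ht hst
  have hgen : {y : ι → ℝ | ∃ S ⊆ J.erase a, (∀ b ∈ S, ∀ c ∈ S, b ≠ c → ¬ rel b c) ∧
      y = incidenceVec S} ⊆ ψ ⁻¹' H := by
    rintro _ ⟨S, hSJ, hS, rfl⟩
    have hSJ' := hSJ.trans (Finset.erase_subset a J)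
    have haS : a ∉ S := fun h => Finset.notMem_erase a J (hSJ h)
    have hSH : incidenceVec S ∈ H := subset_convexHull ℝ _ ⟨S, hSJ', hS, rfl⟩
    have hcard : ∑ b ∈ N, incidenceVec S b = (#(N ∩ S) : ℝ) := by
      simp only [incidenceVec_apply, Finset.sum_ite_mem, Finset.sum_const, nsmul_eq_mul, mul_one]
    rw [Set.mem_preimage]
    rcases (N ∩ S).eq_empty_or_nonempty with he | hne
    · have hins : incidenceVec (insert a S) ∈ H := by
        refine subset_convexHull ℝ _ ⟨insert a S, Finset.insert_subset haJ hSJ', ?_, rfl⟩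
        have hfree : ∀ b ∈ S, ¬ rel a b := by
          intro b hb hab
          have : b ∈ N ∩ S :=
            Finset.mem_inter.2 ⟨hN b (hSJ' hb) (fun e => haS (e ▸ hb)) hab, hb⟩
          simp [he] at this
        intro b hb c hc hbc
        rcases Finset.mem_insert.1 hb with rfl | hb' <;> rcases Finset.mem_insert.1 hc with rfl | hc'
        · exact absurd rfl hbc
        · exact hfree c hc'
        · exact fun h => hfree b hb' (hsymm _ _ h)
        · exact hS b hb' c hc' hbc
      have : ψ (incidenceVec S) = (1 - α) • incidenceVec S + α • incidenceVec (insert a S) := by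
        ext i
        simp only [ψ, hcard, he, Pi.add_apply, Pi.smul_apply, smul_eq_mul, Finset.card_empty]
        simp only [incidenceVec_apply, Finset.mem_insert]
        by_cases hia : i = a
        · subst hia; simp [haS]
        · by_cases hiS : i ∈ S <;> simp [hia, hiS]
      rw [this]
      exact convex_convexHull ℝ _ hSH hins (by linarith) hα0 (by ring)
    · have hone : #(N ∩ S) = 1 := by
        refine le_antisymm (Finset.card_le_one.2 fun b hb c hc => ?_) hne.card_pos
        rw [Finset.mem_inter] at hb hc
        by_contra hbc
        exact hS b hb.2 c hc.2 hbc (hNN b hb.1 c hc.1 hbc)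
      have : ψ (incidenceVec S) = incidenceVec S := by
        ext i
        simp [ψ, hcard, hone]
      rwa [this]
  have hmem := convexHull_min hgen hconv hz'
  rw [Set.mem_preimage] at hmem
  convert hmem using 1
  ext i
  have hσ' : ∑ b ∈ N, (if b ∈ J.erase a then z b else 0) = σ :=
    Finset.sum_congr rfl fun b hb => if_pos (hNJ hb)
  simp only [ψ, hσ', hα]
  by_cases hia : i = a
  · subst hia; simp [haJ]
  · simp [hia]

/-! ### Connected co-3-plexes of chordal graphs -/

theorem IsCoPlex.mono {G : SimpleGraph V} {k : ℕ} {S T : Finset V} (hT : G.IsCoPlex k T)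
    (h : S ⊆ T) : G.IsCoPlex k S := fun v hv =>
  (Set.ncard_le_ncard (t := {w | w ∈ T ∧ G.Adj v w}) (fun _ hw => ⟨h hw.1, hw.2⟩)
    (T.finite_toSet.subset fun _ hw => hw.1)).trans_lt (hT v (h hv))

theorem IsCoPlex.eq_or_eq_or_eq {G : SimpleGraph V} {S : Finset V} (hS : G.IsCoPlex 3 S)
    {v a b c : V} (hv : v ∈ S) (ha : a ∈ S) (hb : b ∈ S) (hc : c ∈ S) (hva : G.Adj v a)
    (hvb : G.Adj v b) (hvc : G.Adj v c) : a = b ∨ a = c ∨ b = c := by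
  by_contra! hne
  have hfin : {w | w ∈ S ∧ G.Adj v w}.Finite := S.finite_toSet.subset fun _ hw => hw.1
  have := (Set.two_lt_ncard_iff hfin).2
    ⟨a, b, c, ⟨ha, hva⟩, ⟨hb, hvb⟩, ⟨hc, hvc⟩, hne.1, hne.2.1, hne.2.2⟩
  have := hS v hv
  omega

/-- `f 0, …, f n` are the vertices of an induced path, in order. -/
def IsInducedSequence (G : SimpleGraph V) (n : ℕ) (f : ℕ → V) : Prop :=
  ∀ i j, i < j → j ≤ n → f i ≠ f j ∧ (G.Adj (f i) (f j) ↔ j = i + 1)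

theorem IsInducedSequence.reverse {G : SimpleGraph V} {n : ℕ} {f : ℕ → V}
    (h : G.IsInducedSequence n f) : G.IsInducedSequence n (fun i => f (n - i)) := by
  intro i j hij hj
  have := h (n - j) (n - i) (by omega) (by omega)
  refine ⟨this.1.symm, (G.adj_comm _ _).trans (this.2.trans ?_)⟩
  omega

theorem IsInducedSequence.extend {G : SimpleGraph V} {n : ℕ} {f : ℕ → V}
    (h : G.IsInducedSequence n f) {w : V} (hw : ∀ i ≤ n, f i ≠ w ∧ (G.Adj (f i) w ↔ i = n)) :
    G.IsInducedSequence (n + 1) (Function.update f (n + 1) w) := by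
  intro i j hij hj
  rw [Function.update_of_ne (by omega : i ≠ n + 1)]
  rcases hj.eq_or_lt with rfl | hj
  · rw [Function.update_self]
    refine ⟨(hw i (by omega)).1, (hw i (by omega)).2.trans ?_⟩
    omega
  · rw [Function.update_of_ne (by omega : j ≠ n + 1)]
    exact h i j hij (by omega)

theorem IsInducedSequence.isInducedPathSet [DecidableEq V] {G : SimpleGraph V} {n : ℕ}
    {f : ℕ → V} (h : G.IsInducedSequence n f) (hn : 1 ≤ n) :
    G.IsInducedPathSet ((Finset.range (n + 1)).image f) := by
  refine ⟨n, hn, ⟨⟨fun i => f i.1, fun i j hij => ?_⟩, fun {i j} => ?_⟩, ?_⟩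
  · have hi := i.2
    have hj := j.2
    rcases lt_trichotomy i.1 j.1 with hlt | heq | hlt
    · exact absurd hij (h _ _ hlt (by omega)).1
    · exact Fin.ext heq
    · exact absurd hij.symm (h _ _ hlt (by omega)).1
  · have hi := i.2
    have hj := j.2
    rw [pathGraph_adj]
    change G.Adj (f i.1) (f j.1) ↔ _
    rcases lt_trichotomy i.1 j.1 with hlt | heq | hlt
    · rw [(h _ _ hlt (by omega)).2]; omega
    · rw [heq]; simp
    · rw [G.adj_comm, (h _ _ hlt (by omega)).2]; omega
  · ext v
    simp only [Set.mem_range, Finset.coe_image, Finset.coe_range, Set.mem_image, Set.mem_Iio]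
    constructor
    · rintro ⟨i, rfl⟩
      exact ⟨i.1, i.2, rfl⟩
    · rintro ⟨i, hi, rfl⟩
      exact ⟨⟨i, hi⟩, rfl⟩

/-- A connected co-3-plex of a chordal graph is a triangle or an induced path. -/
theorem IsChordal.triangle_or_path [DecidableEq V] {G : SimpleGraph V} (hG : G.IsChordal)
    (C : Finset V) (hne : C.Nonempty) (hC : G.IsCutConnected C) (hplex : G.IsCoPlex 3 C) :
    G.IsNClique 3 C ∨ ∃ n f, G.IsInducedSequence n f ∧ C = (Finset.range (n + 1)).image f := by
  induction C using Finset.strongInduction with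
  | H C ih =>
  obtain ⟨w, hw, hsimp⟩ := hG.exists_simplicial hne
  rcases (C.erase w).eq_empty_or_nonempty with he | hne'
  · refine Or.inr ⟨0, fun _ => w, fun i j hij hj => by omega, ?_⟩
    rw [← Finset.insert_erase hw, he]
    simp
  obtain ⟨w', hw', a, ha, haw, hwa⟩ := hC {w} (by simpa using hw) (by simp) (by
    rintro rfl; simp at hne')
  obtain rfl := Finset.mem_singleton.1 hw'
  rw [Finset.mem_singleton] at haw
  -- Two neighbours of the simplicial vertex form a triangle with it; all three degrees are then
  -- exhausted, so connectedness leaves no further vertex. Otherwise the simplicial vertex is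
  -- pendant at `a`.
  by_cases hb : ∃ b ∈ C, b ≠ a ∧ G.Adj w' b
  · obtain ⟨b, hb, hba, hwb⟩ := hb
    have hab := hsimp a ha b hb hwa hwb hba.symm
    left
    have hsub : ({w', a, b} : Finset V) ⊆ C := by
      simp [Finset.insert_subset_iff, hw, ha, hb]
    have hCe : ({w', a, b} : Finset V) = C := by
      by_contra hne
      obtain ⟨x, hx, y, hy, hyX, hxy⟩ := hC _ hsub (by simp) hne
      simp only [Finset.mem_insert, Finset.mem_singleton, not_or] at hx hyX
      rcases hx with rfl | rfl | rfl
      · rcases hplex.eq_or_eq_or_eq hw ha hb hy hwa hwb hxy with e | e | e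
        · exact hba e.symm
        · exact hyX.2.1 e.symm
        · exact hyX.2.2 e.symm
      · rcases hplex.eq_or_eq_or_eq ha hw hb hy hwa.symm hab hxy with e | e | e
        · exact hwb.ne e
        · exact hyX.1 e.symm
        · exact hyX.2.2 e.symm
      · rcases hplex.eq_or_eq_or_eq hb hw ha hy hwb.symm hab.symm hxy with e | e | e
        · exact hwa.ne e
        · exact hyX.1 e.symm
        · exact hyX.2.1 e.symm
    rw [← hCe]
    exact is3Clique_triple_iff.2 ⟨hwa, hwb, hab⟩
  push Not at hb
  have haE : a ∈ C.erase w' := Finset.mem_erase.2 ⟨haw, ha⟩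
  rcases ih _ (Finset.erase_ssubset hw) hne' (hC.erase hsimp)
    (hplex.mono (Finset.erase_subset _ _)) with htri | ⟨n, f, hf, hCf⟩
  · exfalso
    have hcard : #((C.erase w').erase a) = 2 := by
      rw [Finset.card_erase_of_mem haE, htri.card_eq]
    obtain ⟨b, c, hbc, he⟩ := Finset.card_eq_two.1 hcard
    have hmem : ∀ u, u ∈ (C.erase w').erase a → u ∈ C ∧ G.Adj a u ∧ u ≠ w' := by
      intro u hu
      rw [Finset.mem_erase] at hu
      exact ⟨Finset.mem_of_mem_erase hu.2, htri.isClique haE hu.2 hu.1.symm,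
        Finset.ne_of_mem_erase hu.2⟩
    have hb' := hmem b (by simp [he])
    have hc' := hmem c (by simp [he])
    rcases hplex.eq_or_eq_or_eq ha hw hb'.1 hc'.1 hwa.symm hb'.2.1 hc'.2.1 with e | e | e
    · exact hb'.2.2 e.symm
    · exact hc'.2.2 e.symm
    · exact hbc e
  · right
    suffices hlast : ∃ g, G.IsInducedSequence n g ∧ C.erase w' = (Finset.range (n + 1)).image g ∧
        g n = a by
      obtain ⟨g, hg, hCg, hga⟩ := hlast
      have hgC : ∀ i ≤ n, g i ∈ C.erase w' := fun i hi => by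
        rw [hCg]; exact Finset.mem_image_of_mem _ (by simp; omega)
      refine ⟨n + 1, Function.update g (n + 1) w', hg.extend fun i hi => ?_, ?_⟩
      · have hi' := Finset.mem_erase.1 (hgC i hi)
        refine ⟨hi'.1, fun hadj => ?_, ?_⟩
        · by_contra hin
          exact hb (g i) hi'.2 (hga ▸ (hg i n (by omega) le_rfl).1) hadj.symm
        · rintro rfl
          exact hga ▸ hwa.symm
      · rw [Finset.range_add_one, Finset.image_insert, Function.update_self,
          Finset.image_congr (g := g), ← hCg, Finset.insert_erase hw]
        intro i hi
        have : i < n + 1 := by simpa using hi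
        exact Function.update_of_ne (by omega) _ _
    have haf := haE
    rw [hCf, Finset.mem_image] at haf
    obtain ⟨k, hk, hka⟩ := haf
    rw [Finset.mem_range] at hk
    have hfC : ∀ i ≤ n, f i ∈ C ∧ w' ≠ f i := fun i hi => by
      have : f i ∈ C.erase w' := by
        rw [hCf]; exact Finset.mem_image_of_mem _ (by simp; omega)
      exact ⟨Finset.mem_of_mem_erase this, (Finset.ne_of_mem_erase this).symm⟩
    -- An inner vertex of the path would have degree three: two path neighbours and `w'`.
    have hend : k = n ∨ k = 0 := by
      by_contra! hkn
      have h1 := hf (k - 1) k (by omega) (by omega)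
      have h2 := hf k (k + 1) (by omega) (by omega)
      have h3 := hf (k - 1) (k + 1) (by omega) (by omega)
      rcases hplex.eq_or_eq_or_eq ha hw (hfC (k - 1) (by omega)).1 (hfC (k + 1) (by omega)).1
        hwa.symm (hka ▸ (h1.2.2 (by omega)).symm) (hka ▸ h2.2.2 rfl) with e | e | e
      · exact (hfC _ (by omega)).2 e
      · exact (hfC _ (by omega)).2 e
      · exact h3.1 e
    rcases hend with rfl | rfl
    · exact ⟨f, hf, hCf, hka⟩
    · refine ⟨fun i => f (n - i), hf.reverse, ?_, by simpa using hka⟩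
      rw [hCf]
      ext v
      simp only [Finset.mem_image, Finset.mem_range]
      constructor
      · rintro ⟨i, hi, rfl⟩
        exact ⟨n - i, by omega, by congr 1; omega⟩
      · rintro ⟨i, hi, rfl⟩
        exact ⟨n - i, by omega, rfl⟩

theorem IsInducedPathSet.isCutConnected {G : SimpleGraph V} {P : Finset V}
    (hP : G.IsInducedPathSet P) : G.IsCutConnected P := by
  obtain ⟨n, -, f, hf⟩ := hP
  have hmem : ∀ v, v ∈ P ↔ ∃ i, f i = v := fun v => by
    rw [← Finset.mem_coe, ← hf, Set.mem_range]
  intro X hX ⟨x, hx⟩ hne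
  obtain ⟨y, hy, hyX⟩ := Finset.exists_of_ssubset (hX.ssubset_of_ne hne)
  obtain ⟨i, rfl⟩ := (hmem x).1 (hX hx)
  obtain ⟨j, rfl⟩ := (hmem y).1 hy
  by_contra! hcon
  obtain ⟨p⟩ := pathGraph_preconnected (n + 1) i j
  induction p with
  | nil => exact hyX hx
  | cons hadj p ih =>
    refine ih ?_ hy hyX
    by_contra h
    exact hcon _ hx _ ((hmem _).2 ⟨_, rfl⟩) h (f.map_adj_iff.2 hadj)

theorem IsInducedPathSet.nonempty {G : SimpleGraph V} {P : Finset V}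
    (hP : G.IsInducedPathSet P) : P.Nonempty := by
  obtain ⟨n, -, f, hf⟩ := hP
  exact ⟨f 0, by rw [← Finset.mem_coe, ← hf]; exact ⟨0, rfl⟩⟩

/-- Adjacent path vertices have consecutive indices, and three integers cannot pairwise differ by
one. -/
theorem IsInducedPathSet.card_inter_le [DecidableEq V] {G : SimpleGraph V} {P K : Finset V}
    (hP : G.IsInducedPathSet P) (hK : G.IsClique (K : Set V)) : #(P ∩ K) ≤ 2 := by
  obtain ⟨n, -, f, hf⟩ := hP
  have hmem : ∀ v ∈ P ∩ K, v ∈ K ∧ ∃ i, f i = v := fun v hv => by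
    rw [Finset.mem_inter, ← Finset.mem_coe, ← hf, Set.mem_range] at hv
    exact hv.symm
  by_contra! h
  obtain ⟨a, b, c, ha, hb, hc, hab, hac, hbc⟩ := Finset.two_lt_card_iff.1 h
  obtain ⟨haK, i, rfl⟩ := hmem a ha
  obtain ⟨hbK, j, rfl⟩ := hmem b hb
  obtain ⟨hcK, k, rfl⟩ := hmem c hc
  have h1 := pathGraph_adj.1 (f.map_adj_iff.1 (hK haK hbK hab))
  have h2 := pathGraph_adj.1 (f.map_adj_iff.1 (hK haK hcK hac))
  have h3 := pathGraph_adj.1 (f.map_adj_iff.1 (hK hbK hcK hbc))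
  omega

theorem IsInducedPathSet.isCoPlex {G : SimpleGraph V} {P : Finset V}
    (hP : G.IsInducedPathSet P) : G.IsCoPlex 3 P := by
  obtain ⟨n, -, f, hf⟩ := hP
  have hmem : ∀ v, v ∈ P ↔ ∃ i, f i = v := fun v => by
    rw [← Finset.mem_coe, ← hf, Set.mem_range]
  intro v hv
  have hfin : {w | w ∈ P ∧ G.Adj v w}.Finite := P.finite_toSet.subset fun _ hw => hw.1
  by_contra! h
  obtain ⟨a, b, c, ⟨ha, hva⟩, ⟨hb, hvb⟩, ⟨hc, hvc⟩, hab, hac, hbc⟩ :=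
    (Set.two_lt_ncard_iff hfin).1 (Nat.lt_of_succ_le h)
  obtain ⟨l, rfl⟩ := (hmem v).1 hv
  obtain ⟨i, rfl⟩ := (hmem a).1 ha
  obtain ⟨j, rfl⟩ := (hmem b).1 hb
  obtain ⟨k, rfl⟩ := (hmem c).1 hc
  have h1 := pathGraph_adj.1 (f.map_adj_iff.1 hva)
  have h2 := pathGraph_adj.1 (f.map_adj_iff.1 hvb)
  have h3 := pathGraph_adj.1 (f.map_adj_iff.1 hvc)
  have h4 : i.1 ≠ j.1 := fun e => hab (congrArg f (Fin.ext e))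
  have h5 : i.1 ≠ k.1 := fun e => hac (congrArg f (Fin.ext e))
  have h6 : j.1 ≠ k.1 := fun e => hbc (congrArg f (Fin.ext e))
  omega

theorem isCoPlex_of_card_le {G : SimpleGraph V} {k : ℕ} {S : Finset V} (h : #S ≤ k) :
    G.IsCoPlex k S := by
  classical
  intro v hv
  refine lt_of_lt_of_le ?_ h
  rw [← Set.ncard_coe_finset]
  refine Set.ncard_lt_ncard ⟨fun w hw => hw.1, fun hsub => ?_⟩ S.finite_toSet
  exact (hsub (Finset.mem_coe.2 hv)).2.ne rfl

/-! ### Building blocks and stable families -/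

/-- The building blocks of co-3-plexes: vertices, triangles and induced paths. -/
abbrev Member (G : SimpleGraph V) : Type _ := V ⊕ G.Triangle ⊕ G.InducedPath

/-- The vertex set of a building block. -/
def memberSet (G : SimpleGraph V) : G.Member → Finset V
  | Sum.inl v => {v}
  | Sum.inr (Sum.inl T) => T.1
  | Sum.inr (Sum.inr P) => P.1

theorem memberSet_nonempty (G : SimpleGraph V) (i : G.Member) : (G.memberSet i).Nonempty := by
  rcases i with v | T | P
  · exact Finset.singleton_nonempty v
  · exact Finset.card_pos.1 (by rw [memberSet, T.2.card_eq]; norm_num)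
  · exact P.2.nonempty

theorem memberSet_isCutConnected (G : SimpleGraph V) (i : G.Member) :
    G.IsCutConnected (G.memberSet i) := by
  rcases i with v | T | P
  · exact isCutConnected_singleton G v
  · exact T.2.isClique.isCutConnected
  · exact P.2.isCutConnected

theorem memberSet_isCoPlex (G : SimpleGraph V) (i : G.Member) :
    G.IsCoPlex 3 (G.memberSet i) := by
  rcases i with v | T | P
  · exact isCoPlex_of_card_le (by simp [memberSet])
  · exact isCoPlex_of_card_le T.2.card_eq.le
  · exact P.2.isCoPlex

/-- A set of building blocks is stable if no two of them touch. -/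
def IsStableFamily (G : SimpleGraph V) (S : Finset G.Member) : Prop :=
  ∀ i ∈ S, ∀ j ∈ S, i ≠ j → ¬ G.Touch (G.memberSet i) (G.memberSet j)

/-- All neighbours of a vertex within the union lie in its own block, where degrees are at most two.
-/
theorem IsStableFamily.isCoPlex [DecidableEq V] {G : SimpleGraph V} {S : Finset G.Member}
    (hS : G.IsStableFamily S) : G.IsCoPlex 3 (S.biUnion G.memberSet) := by
  intro v hv
  obtain ⟨i, hi, hvi⟩ := Finset.mem_biUnion.1 hv
  refine (Set.ncard_le_ncard (t := {w | w ∈ G.memberSet i ∧ G.Adj v w}) (fun w hw => ?_)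
    ((G.memberSet i).finite_toSet.subset fun _ hw => hw.1)).trans_lt (memberSet_isCoPlex G i v hvi)
  obtain ⟨j, hj, hwj⟩ := Finset.mem_biUnion.1 hw.1
  refine ⟨?_, hw.2⟩
  by_cases hij : i = j
  · rwa [hij]
  · exact absurd ⟨v, hvi, w, hwj, Or.inr hw.2⟩ (hS i hi j hj hij)

theorem IsChordal.exists_memberSet_eq [DecidableEq V] {G : SimpleGraph V} (hG : G.IsChordal)
    {C : Finset V} (hne : C.Nonempty) (hC : G.IsCutConnected C) (hplex : G.IsCoPlex 3 C) :
    ∃ i, G.memberSet i = C := by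
  rcases hG.triangle_or_path C hne hC hplex with h | ⟨n, f, hf, rfl⟩
  · exact ⟨Sum.inr (Sum.inl ⟨C, h⟩), rfl⟩
  rcases Nat.eq_zero_or_pos n with rfl | hn
  · exact ⟨Sum.inl (f 0), by simp [memberSet]⟩
  · exact ⟨Sum.inr (Sum.inr ⟨_, hf.isInducedPathSet hn⟩), rfl⟩

/-- In a chordal graph, every co-3-plex is the union of a stable family of building blocks. -/
theorem IsChordal.exists_isStableFamily [DecidableEq V] {G : SimpleGraph V} (hG : G.IsChordal)
    (S : Finset V) (hS : G.IsCoPlex 3 S) :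
    ∃ F : Finset G.Member, G.IsStableFamily F ∧ F.biUnion G.memberSet = S := by
  induction S using Finset.strongInduction with
  | H S ih =>
  rcases S.eq_empty_or_nonempty with rfl | hne
  · exact ⟨∅, by simp [IsStableFamily], by simp⟩
  obtain ⟨C, hCS, hCne, hC, hclosed⟩ := G.exists_component hne
  obtain ⟨i, rfl⟩ := hG.exists_memberSet_eq hCne hC (hS.mono hCS)
  obtain ⟨F, hF, hFS⟩ := ih (S \ G.memberSet i) (Finset.sdiff_ssubset hCS hCne)
    (hS.mono Finset.sdiff_subset)
  have hnt : ∀ j ∈ F, ¬ G.Touch (G.memberSet i) (G.memberSet j) := by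
    rintro j hj ⟨a, ha, b, hb, hab⟩
    have hb' : b ∈ S \ G.memberSet i := hFS ▸ Finset.mem_biUnion.2 ⟨j, hj, hb⟩
    rw [Finset.mem_sdiff] at hb'
    rcases hab with rfl | hab
    · exact hb'.2 ha
    · exact hb'.2 (hclosed a ha b hb'.1 hab)
  refine ⟨insert i F, ?_, ?_⟩
  · intro j hj k hk hjk
    rcases Finset.mem_insert.1 hj with rfl | hj' <;> rcases Finset.mem_insert.1 hk with rfl | hk'
    · exact absurd rfl hjk
    · exact hnt k hk'
    · exact fun h => hnt j hj' h.symm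
    · exact hF j hj' k hk' hjk
  · rw [Finset.biUnion_insert, hFS, Finset.union_sdiff_of_subset hCS]

/-! ### The stable set polytope of the touching graph -/

/-- The weights on the building blocks in which every maximal clique is met by total weight at
most one. -/
def feasibleWeights [Fintype V] [DecidableEq V] (G : SimpleGraph V) : Set (G.Member → ℝ) :=
  {z | (∀ i, 0 ≤ z i) ∧ ∀ K : Finset V, Maximal G.IsClique (K : Set V) →
    ∑ i with (G.memberSet i ∩ K).Nonempty, z i ≤ 1}

theorem IsClique.touch [DecidableEq V] {G : SimpleGraph V} {A B K : Finset V}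
    (hK : G.IsClique (K : Set V)) (hA : (A ∩ K).Nonempty) (hB : (B ∩ K).Nonempty) :
    G.Touch A B := by
  obtain ⟨a, ha⟩ := hA
  obtain ⟨b, hb⟩ := hB
  rw [Finset.mem_inter] at ha hb
  exact ⟨a, ha.1, b, hb.1, or_iff_not_imp_left.2 fun h => hK ha.2 hb.2 h⟩

theorem IsStableFamily.incidenceVec_mem [Fintype V] [DecidableEq V] {G : SimpleGraph V}
    {S : Finset G.Member} (hS : G.IsStableFamily S) : incidenceVec S ∈ G.feasibleWeights := by
  refine ⟨fun i => ?_, fun K hK => ?_⟩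
  · rw [incidenceVec_apply]; split_ifs <;> norm_num
  · simp only [incidenceVec_apply, Finset.sum_ite_mem, Finset.sum_const, nsmul_eq_mul, mul_one]
    norm_cast
    refine Finset.card_le_one.2 fun i hi j hj => ?_
    rw [Finset.mem_inter, Finset.mem_filter] at hi hj
    by_contra hij
    exact hS i hi.2 j hj.2 hij (hK.prop.touch hi.1.2 hj.1.2)

theorem exists_maximal_isClique [Finite V] {G : SimpleGraph V} {s : Set V} (hs : G.IsClique s) :
    ∃ K : Finset V, s ⊆ K ∧ Maximal G.IsClique (K : Set V) := by
  classical
  obtain ⟨t, hst, ht⟩ := Finite.exists_le_maximal hs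
  exact ⟨t.toFinite.toFinset, by simpa using hst, by simpa using ht⟩

theorem IsChordal.feasibleWeights_eq [Fintype V] [DecidableEq V] {G : SimpleGraph V}
    (hG : G.IsChordal) :
    G.feasibleWeights = convexHull ℝ {z | ∃ S, G.IsStableFamily S ∧ z = incidenceVec S} := by
  classical
  refine Set.Subset.antisymm (fun z hz => ?_) (convexHull_min ?_ ?_)
  · obtain ⟨r, hr, hpe⟩ := hG.exists_perfectElimination
    choose top htop hmax using fun i : G.Member =>
      (G.memberSet i).exists_max_image r (G.memberSet_nonempty i)
    have key := mem_convexHull_of_elimination (fun i j => G.Touch (G.memberSet i) (G.memberSet j))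
      (fun _ _ h => h.symm) z hz.1 Finset.univ (fun I _ hI => by
        -- The block to eliminate is the one whose last vertex comes earliest. That vertex and its
        -- later neighbours form a clique, so a single clique inequality bounds the weight of the
        -- whole neighbourhood.
        obtain ⟨a, ha, hmin⟩ := I.exists_min_image (fun i => r (top i)) hI
        have hclique : G.IsClique {u | u = top a ∨ (r (top a) < r u ∧ G.Adj (top a) u)} := by
          rintro u hu v hv huv
          rcases hu with rfl | hu <;> rcases hv with rfl | hv
          · exact absurd rfl huv
          · exact hv.2
          · exact hu.2.symm
          · exact hpe _ u v hu.1 hv.1 hu.2 hv.2 huv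
        obtain ⟨K, hKsub, hK⟩ := exists_maximal_isClique hclique
        have hmeet : ∀ b ∈ I, G.Touch (G.memberSet a) (G.memberSet b) →
            (G.memberSet b ∩ K).Nonempty := by
          intro b hb hab
          obtain ⟨u, hu, h⟩ := hpe.exists_mem_of_touch hr (G.memberSet_isCutConnected a)
            (G.memberSet_isCutConnected b) hab (htop a) (hmax a) (htop b) (hmin b hb)
          exact ⟨u, Finset.mem_inter.2 ⟨hu, hKsub h⟩⟩
        refine ⟨a, ha, {b ∈ I.erase a | G.Touch (G.memberSet a) (G.memberSet b)},
          Finset.filter_subset _ _, fun b hb hba hab => by simp [hb, hba, hab], ?_, ?_⟩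
        · intro b hb c hc _
          rw [Finset.mem_filter, Finset.mem_erase] at hb hc
          exact hK.prop.touch (hmeet b hb.1.2 hb.2) (hmeet c hc.1.2 hc.2)
        · rw [← Finset.sum_insert (by simp)]
          refine (Finset.sum_le_sum_of_subset_of_nonneg (fun b hb => ?_)
            (fun i _ _ => hz.1 i)).trans (hz.2 K hK)
          rw [Finset.mem_filter]
          refine ⟨Finset.mem_univ _, ?_⟩
          rcases Finset.mem_insert.1 hb with rfl | hb
          · exact hmeet b ha ⟨top b, htop b, top b, htop b, Or.inl rfl⟩
          · rw [Finset.mem_filter, Finset.mem_erase] at hb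
            exact hmeet b hb.1.2 hb.2)
    simpa [IsStableFamily] using key
  · rintro _ ⟨S, hS, rfl⟩
    exact hS.incidenceVec_mem
  · intro x hx y hy s t hs ht hst
    refine ⟨fun i => ?_, fun K hK => ?_⟩
    · have := hx.1 i
      have := hy.1 i
      simp only [Pi.add_apply, Pi.smul_apply, smul_eq_mul]
      positivity
    · simp only [Pi.add_apply, Pi.smul_apply, smul_eq_mul, Finset.sum_add_distrib,
        ← Finset.mul_sum]
      nlinarith [mul_le_mul_of_nonneg_left (hx.2 K hK) hs, mul_le_mul_of_nonneg_left (hy.2 K hK) ht]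

/-! ### Change of variables -/

/-- The point `(x, t, p)` given by weights on the building blocks: `x v` is the total weight of
the blocks containing `v`. -/
noncomputable def toExtSpace [Fintype V] [DecidableEq V] (G : SimpleGraph V) :
    (G.Member → ℝ) →ₗ[ℝ] G.ExtSpace where
  toFun z := (fun v => ∑ i with v ∈ G.memberSet i, z i,
    fun T => z (Sum.inr (Sum.inl T)), fun P => z (Sum.inr (Sum.inr P)))
  map_add' z z' := by
    ext <;> simp [Finset.sum_add_distrib]
  map_smul' c z := by
    ext <;> simp [Finset.mul_sum]

theorem toExtSpace_fst_apply [Fintype V] [DecidableEq V] (G : SimpleGraph V)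
    (t : G.Triangle → ℝ) (p : G.InducedPath → ℝ) (s : V → ℝ) (v : V) :
    (G.toExtSpace (Sum.elim s (Sum.elim t p))).1 v =
      s v + (G.triangleSum t {v} 1 + G.pathSum p {v} 1) := by
  have hcard : ∀ A : Finset V, #(A ∩ {v}) = 1 ↔ v ∈ A := fun A => by
    by_cases h : v ∈ A <;> simp [h]
  simp only [toExtSpace, LinearMap.coe_mk, AddHom.coe_mk, Finset.sum_filter, triangleSum, pathSum,
    hcard]
  simp [Fintype.sum_sum_type, memberSet]
  rfl

/-- After the change of variables, the clique inequalities bound the weight meeting the clique. -/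
theorem clique_sum_toExtSpace [Fintype V] [DecidableEq V] (G : SimpleGraph V) {K : Finset V}
    (hK : G.IsClique (K : Set V)) (z : G.Member → ℝ) :
    ∑ v ∈ K, (G.toExtSpace z).1 v - G.triangleSum (G.toExtSpace z).2.1 K 2
        - 2 * G.triangleSum (G.toExtSpace z).2.1 K 3 - G.pathSum (G.toExtSpace z).2.2 K 2 =
      ∑ i with (G.memberSet i ∩ K).Nonempty, z i := by
  have h1 : ∑ v ∈ K, (G.toExtSpace z).1 v = ∑ i, (#(G.memberSet i ∩ K) : ℝ) * z i := by
    simp only [toExtSpace, LinearMap.coe_mk, AddHom.coe_mk, Finset.sum_filter]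
    rw [Finset.sum_comm]
    refine Finset.sum_congr rfl fun i _ => ?_
    rw [Finset.sum_ite_mem, Finset.sum_const, nsmul_eq_mul, Finset.inter_comm]
  have hV : ∀ v : V, (#(G.memberSet (Sum.inl v) ∩ K) : ℝ) * z (Sum.inl v) =
      if (G.memberSet (Sum.inl v) ∩ K).Nonempty then z (Sum.inl v) else 0 := fun v => by
    by_cases h : v ∈ K <;> simp [memberSet, h]
  have hT : ∀ T : G.Triangle, (#(G.memberSet (Sum.inr (Sum.inl T)) ∩ K) : ℝ) * z (Sum.inr (Sum.inl T)) =
      (if (G.memberSet (Sum.inr (Sum.inl T)) ∩ K).Nonempty then z (Sum.inr (Sum.inl T)) else 0)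
        + (if #(T.1 ∩ K) = 2 then z (Sum.inr (Sum.inl T)) else 0)
        + 2 * (if #(T.1 ∩ K) = 3 then z (Sum.inr (Sum.inl T)) else 0) := fun T => by
    have hle : #(T.1 ∩ K) ≤ 3 := 
      (Finset.card_le_card Finset.inter_subset_left).trans_eq T.2.card_eq
    simp only [← Finset.card_pos, memberSet]
    generalize #(T.1 ∩ K) = m at hle
    -- For `m ≤ 3`, `m = [m ≥ 1] + [m = 2] + 2[m = 3]`, which explains the coefficients of the
    -- clique inequality.
    interval_cases m <;> norm_num <;> ring
  have hP : ∀ P : G.InducedPath, (#(G.memberSet (Sum.inr (Sum.inr P)) ∩ K) : ℝ) * z (Sum.inr (Sum.inr P)) =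
      (if (G.memberSet (Sum.inr (Sum.inr P)) ∩ K).Nonempty then z (Sum.inr (Sum.inr P)) else 0)
        + (if #(P.1 ∩ K) = 2 then z (Sum.inr (Sum.inr P)) else 0) := fun P => by
    have hle : #(P.1 ∩ K) ≤ 2 := P.2.card_inter_le hK
    simp only [← Finset.card_pos, memberSet]
    generalize #(P.1 ∩ K) = m at hle
    interval_cases m <;> norm_num
    ring
  rw [h1, Finset.sum_filter]
  simp only [Fintype.sum_sum_type, hV, hT, hP, Finset.sum_add_distrib, ← Finset.mul_sum,
    triangleSum, pathSum, Finset.sum_filter, toExtSpace, LinearMap.coe_mk, AddHom.coe_mk]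
  ring

theorem extendedPolytope_eq_image [Fintype V] [DecidableEq V] (G : SimpleGraph V) :
    G.extendedPolytope = G.toExtSpace '' G.feasibleWeights := by
  have hiff : ∀ s t p, G.toExtSpace (Sum.elim s (Sum.elim t p)) ∈ G.extendedPolytope ↔
      Sum.elim s (Sum.elim t p) ∈ G.feasibleWeights := by
    intro s t p
    constructor
    · rintro ⟨hK, hv, hp, ht⟩
      refine ⟨?_, fun K hmax => (clique_sum_toExtSpace G hmax.prop _).symm.trans_le (hK K hmax)⟩
      rintro (v | T | P)
      · have := hv v
        rw [toExtSpace_fst_apply] at this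
        exact le_of_add_le_add_right ((zero_add _).trans_le this)
      · exact ht T
      · exact hp P
    · rintro ⟨h0, hK⟩
      refine ⟨fun K hmax => (clique_sum_toExtSpace G hmax.prop _).trans_le (hK K hmax),
        fun v => ?_, fun P => h0 (Sum.inr (Sum.inr P)), fun T => h0 (Sum.inr (Sum.inl T))⟩
      rw [toExtSpace_fst_apply]
      exact le_add_of_nonneg_left (h0 (Sum.inl v))
  ext ⟨x, t, p⟩
  constructor
  · intro h
    -- The preimage takes the slack of the vertex inequality as singleton weight.
    have he : G.toExtSpace (Sum.elim (fun v => x v - (G.triangleSum t {v} 1 + G.pathSum p {v} 1))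
        (Sum.elim t p)) = (x, t, p) := by
      refine Prod.ext (funext fun v => ?_) rfl
      rw [toExtSpace_fst_apply]
      exact sub_add_cancel _ _
    exact ⟨_, (hiff _ _ _).1 (he ▸ h), he⟩
  · rintro ⟨z, hz, he⟩
    have hz' : z = Sum.elim (fun v => z (Sum.inl v)) (Sum.elim (fun T => z (Sum.inr (Sum.inl T)))
        (fun P => z (Sum.inr (Sum.inr P)))) := by
      ext (v | T | P) <;> rfl
    rw [← he, hz']
    rw [hz'] at hz
    exact (hiff _ _ _).2 hz

theorem IsChordal.extendedPolytope_eq [Fintype V] [DecidableEq V] {G : SimpleGraph V}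
    (hG : G.IsChordal) : G.extendedPolytope =
      convexHull ℝ (G.toExtSpace '' {z | ∃ S, G.IsStableFamily S ∧ z = incidenceVec S}) := by
  rw [extendedPolytope_eq_image, hG.feasibleWeights_eq, LinearMap.image_convexHull]

/-- Blocks of a stable family are disjoint, so each vertex is counted at most once. -/
theorem toExtSpace_incidenceVec_fst [Fintype V] [DecidableEq V] {G : SimpleGraph V}
    {S : Finset G.Member} (hS : G.IsStableFamily S) :
    (G.toExtSpace (incidenceVec S)).1 = incidenceVec (S.biUnion G.memberSet) := by
  ext v
  simp only [toExtSpace, LinearMap.coe_mk, AddHom.coe_mk, incidenceVec_apply, Finset.sum_ite_mem,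
    Finset.sum_const, nsmul_eq_mul, mul_one]
  split_ifs with h
  · obtain ⟨i, hi, hvi⟩ := Finset.mem_biUnion.1 h
    rw [Nat.cast_eq_one, Finset.card_eq_one]
    refine ⟨i, Finset.eq_singleton_iff_unique_mem.2 ⟨by simp [hi, hvi], fun j hj => ?_⟩⟩
    rw [Finset.mem_inter, Finset.mem_filter] at hj
    by_contra hji
    exact hS j hj.2 i hi hji ⟨v, hj.1.2, v, hvi, Or.inl rfl⟩
  · rw [Nat.cast_eq_zero, Finset.card_eq_zero]
    refine Finset.eq_empty_of_forall_notMem fun j hj => h ?_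
    rw [Finset.mem_inter, Finset.mem_filter] at hj
    exact Finset.mem_biUnion.2 ⟨j, hj.2, hj.1.2⟩

/-! ### Integrality of faces and the main theorem -/

theorem exists_int_incidenceVec_eq {ι : Type*} [DecidableEq ι] (S : Finset ι) (i : ι) :
    ∃ m : ℤ, incidenceVec S i = m :=
  ⟨if i ∈ S then 1 else 0, by rw [incidenceVec_apply]; split_ifs <;> simp⟩

theorem isIntegerPoint_toExtSpace [Fintype V] [DecidableEq V] {G : SimpleGraph V}
    {S : Finset G.Member} (hS : G.IsStableFamily S) :
    G.IsIntegerPoint (G.toExtSpace (incidenceVec S)) := by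
  refine ⟨fun v => ?_, fun T => exists_int_incidenceVec_eq S _,
    fun P => exists_int_incidenceVec_eq S _⟩
  rw [toExtSpace_incidenceVec_fst hS]
  exact exists_int_incidenceVec_eq _ v

/-- The convex hull of a set of integer points is an integer polyhedron. -/
theorem isIntegerPolyhedron_convexHull {G : SimpleGraph V} {s : Set G.ExtSpace}
    (hs : ∀ y ∈ s, G.IsIntegerPoint y) : G.IsIntegerPolyhedron (convexHull ℝ s) := by
  intro F hF hne
  obtain ⟨l, rfl⟩ := hF hne
  obtain ⟨y, hy, hmax⟩ := hne
  by_contra! hcon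
  -- If no generator attained the maximum of `l`, the generators, and hence their hull, would lie in
  -- an open half-space excluding the maximiser `y`.
  have hlt : s ⊆ {g | l g < l y} := by
    intro g hg
    have hgs := subset_convexHull ℝ s hg
    refine lt_of_not_ge fun hle => hcon g ⟨hgs, fun x hx => (hmax x hx).trans hle⟩ (hs g hg)
  exact lt_irrefl (l y) (convexHull_min hlt (convex_halfSpace_lt l.toLinearMap.isLinear _) hy)

end SimpleGraph

theorem mainTheorem2 {V : Type*} [Fintype V] [DecidableEq V] (G : SimpleGraph V)
    (hG : G.IsChordal) :
    (Bornology.IsBounded G.extendedPolytope ∧ G.IsIntegerPolyhedron G.extendedPolytope) ∧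
      G.coThreePlexPolytope = G.projX G.extendedPolytope := by
  have hprojX : G.projX G.extendedPolytope = LinearMap.fst ℝ _ _ '' G.extendedPolytope := by
    ext x
    constructor
    · rintro ⟨t, p, h⟩
      exact ⟨_, h, rfl⟩
    · rintro ⟨⟨x, t, p⟩, h, rfl⟩
      exact ⟨t, p, h⟩
  rw [hprojX, hG.extendedPolytope_eq]
  refine ⟨⟨isBounded_convexHull.2 (Set.Finite.isBounded (Set.Finite.image _ ?_)),
    SimpleGraph.isIntegerPolyhedron_convexHull ?_⟩, ?_⟩
  · refine (Set.finite_range (SimpleGraph.incidenceVec (V := G.Member))).subset ?_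
    rintro _ ⟨S, -, rfl⟩
    exact ⟨S, rfl⟩
  · rintro _ ⟨_, ⟨S, hS, rfl⟩, rfl⟩
    exact SimpleGraph.isIntegerPoint_toExtSpace hS
  · rw [LinearMap.image_convexHull, SimpleGraph.coThreePlexPolytope]
    congr 1
    ext x
    constructor
    · rintro ⟨S, hS, rfl⟩
      obtain ⟨F, hF, rfl⟩ := hG.exists_isStableFamily S hS
      exact ⟨_, ⟨_, ⟨F, hF, rfl⟩, rfl⟩, SimpleGraph.toExtSpace_incidenceVec_fst hF⟩
    · rintro ⟨_, ⟨_, ⟨F, hF, rfl⟩, rfl⟩, rfl⟩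
      exact ⟨_, hF.isCoPlex, SimpleGraph.toExtSpace_incidenceVec_fst hF⟩
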